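/- Let $\mathcal H$ and $\mathcal G$ be real Hilbert spaces, let $f\colon\mathcal H\to\left]-\infty,+\infty\right]$ and $g\colon\mathcal G\to\left]-\infty,+\infty\right]$ be proper lower semicontinuous convex functions, and let $L\colon\mathcal H\to\mathcal G$ be a nonzero bounded linear operator with adjoint $L^*$. Suppose that $0\in\operatorname{ran}(\partial f+L^*\circ\partial g\circ L)$, i.e., that there is $x\in\mathcal H$ with $0\in\partial f(x)+L^*(\partial g(Lx))$. Consider the primal problem \[ \underset{x\in\mathcal H}{\text{minimize}}\;\; f(x)+g(Lx)\qquad(\mathrm P) \] and the dual problem \[ \underset{v\in\mathcal G}{\text{minimize}}\;\; f^*(-L^*v)+g^*(v),\qquad(\mathrm D) \] where $f^*\colon u\mapsto\sup_{x}(\langle x,u\rangle-f(x))$ is the conjugate of $f$, and likewise $g^*$. For a proper lower semicontinuous convex function $h$, $\operatorname{prox}_h x$ denotes the unique minimizer of $y\mapsto h(y)+\frac12\|x-y\|^2$. Let $\varepsilon>0$, let $(\gamma_n)_{n\in\mathbb N}$ be real numbers such that \[ \varepsilon\leq\gamma_n\leq\frac{1-\varepsilon}{\sqrt{1+\|L\|^2}}\qquad\text{for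 every } n\in\mathbb N, \] let $(x_0,y_0,v_0)\in\mathcal H\times\mathcal G\times\mathcal G$ be arbitrary, and iterate, for $n=0,1,\dots$, \begin{align*} r_n&=\gamma_n(Lx_n-y_n),\\ p_n&=\operatorname{prox}_{\gamma_n f}(x_n-\gamma_nL^*v_n),\\ q_n&=\operatorname{prox}_{\gamma_n g}(y_n+\gamma_nv_n),\\ x_{n+1}&=p_n-\gamma_nL^*r_n,\\ y_{n+1}&=q_n+\gamma_nr_n,\\ v_{n+1}&=v_n+\gamma_n(Lp_n-q_n). \end{align*} Then $(x_n)_{n\in\mathbb N}$ converges weakly to a solution of $(\mathrm P)$ and $(v_n)_{n\in\mathbb N}$ converges weakly to a solution of $(\mathrm D)$. -/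

import Mathlib

open Filter Topology
open scoped Pointwise InnerProductSpace

namespace ConvexDuality

variable {E : Type*} [NormedAddCommGroup E] [InnerProductSpace ℝ E]

/-- The class `Γ₀(E)` of proper lower semicontinuous convex functions from `E` to `]-∞, +∞]`,
seen as extended-real-valued functions that never take the value `-∞`. -/
structure IsGammaZero (f : E → EReal) : Prop where
  ne_bot : ∀ x, f x ≠ ⊥
  exists_ne_top : ∃ x, f x ≠ ⊤
  lowerSemicontinuous : LowerSemicontinuous f
  convex : ∀ x y : E, ∀ a b : ℝ, 0 < a → 0 < b → a + b = 1 →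
    f (a • x + b • y) ≤ (a : EReal) * f x + (b : EReal) * f y

/-- The subdifferential `∂f`, as a set-valued operator. -/
def subdifferential (f : E → EReal) (x : E) : Set E :=
  {u | ∀ y, ((⟪y - x, u⟫_ℝ : ℝ) : EReal) + f x ≤ f y}

/-- The conjugate `f^*`. -/
noncomputable def conjugate (f : E → EReal) (u : E) : EReal :=
  ⨆ x, ((⟪x, u⟫_ℝ : ℝ) : EReal) - f x

/-- The set of global minimizers of `F`. -/
def argminSet (F : E → EReal) : Set E :=
  {x | ∀ y, F x ≤ F y}

open Classical in
/-- The unique global minimizer of `F` when there is exactly one (and `0` by convention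
otherwise). -/
noncomputable def argmin (F : E → EReal) : E :=
  if h : ∃! x, x ∈ argminSet F then h.choose else 0

/-- The proximity operator of `f`: `prox f x` is the minimizer of `f + ‖x - ·‖² / 2`. -/
noncomputable def prox (f : E → EReal) (x : E) : E :=
  argmin fun y => f y + ((1 / 2 * ‖x - y‖ ^ 2 : ℝ) : EReal)

/-- The function `γ f`, for a real number `γ` (only used with `γ > 0`). -/
noncomputable def scale (γ : ℝ) (f : E → EReal) (x : E) : EReal :=
  (γ : EReal) * f x

/-- Weak convergence of the sequence `x` to `a`. -/
def WeaklyConvergesTo (x : ℕ → E) (a : E) : Prop :=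
  Tendsto (fun n => toWeakSpace ℝ E (x n)) atTop (𝓝 (toWeakSpace ℝ E a))

variable {H G : Type*} [NormedAddCommGroup H] [InnerProductSpace ℝ H] [CompleteSpace H]
  [NormedAddCommGroup G] [InnerProductSpace ℝ G] [CompleteSpace G]

/-- The primal objective `x ↦ f(x) + g(Lx)`. -/
noncomputable def primalObjective (f : H → EReal) (g : G → EReal) (L : H →L[ℝ] G) (x : H) : EReal :=
  f x + g (L x)

/-- The dual objective `v ↦ f^*(-L^*v) + g^*(v)`. -/
noncomputable def dualObjective (f : H → EReal) (g : G → EReal) (L : H →L[ℝ] G) (v : G) : EReal :=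
  conjugate f (-(L.adjoint v)) + conjugate g v

/-- The set-valued operator `∂f + L^* ∘ ∂g ∘ L`. -/
noncomputable def primalOperator (f : H → EReal) (g : G → EReal) (L : H →L[ℝ] G) (x : H) : Set H :=
  subdifferential f x + L.adjoint '' subdifferential g (L x)

/-- The range of a set-valued operator. -/
def setValuedRange (A : H → Set H) : Set H :=
  {u | ∃ x, u ∈ A x}

end ConvexDuality

open ConvexDuality

/-!
The pairs `(x, v)` with `-L^* v ∈ ∂f(x)` and `v ∈ ∂g(Lx)` are primal-dual solutions, and they are
the zeros `((x, Lx), v)` of `(∂f × ∂g × 0) + S` on `(H × G) × G`, where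
`S(w, v) = (T^* v, -T w)` is the skew map of the constraint `T(x, y) = Lx - y = 0`. In these
variables the iteration is Tseng's forward-backward-forward method, that is, a step
`z ↦ z - γ u` along an element `u` of the operator at a nearby point `p`, where `γ u` approximates
`z - p` with relative error at most `γ ‖S‖ ≤ γ √(1 + ‖L‖²) ≤ 1 - ε`. Monotonicity then makes the
iterates Fejér monotone with respect to the zeros and forces `z - p → 0` and `u → 0`. Since the
graph of a maximally monotone operator is closed in the weak-strong topology along bounded
sequences, weak cluster points are zeros, and Opial's argument yields weak convergence.
-/

namespace ConvexDuality

section StrongConvexity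

variable {E : Type*} [NormedAddCommGroup E] [InnerProductSpace ℝ E] {s : Set E} {m : ℝ} {F : E → ℝ}

theorem sub_le_of_strongConvexOn_of_le_norm_sub (hF : StrongConvexOn s m F) (hm : 0 < m) {a y : E}
    (ha : a ∈ s) (hy : y ∈ s) {δ : ℝ} (hδ : 0 < δ) (hya : δ ≤ ‖y - a‖)
    (hnear : ∀ z ∈ s, ‖z - a‖ < δ → F a - 1 < F z) : F a - 4 / (m * δ ^ 2) ≤ F y := by
  set d := ‖y - a‖
  have hd : 0 < d := hδ.trans_le hya
  -- Compare `a` and `y` through the point of the segment `[a, y]` at distance `δ / 2` from `a`.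
  obtain ⟨t, ht⟩ : ∃ t, t = δ / (2 * d) := ⟨_, rfl⟩
  have ht0 : 0 < t := ht ▸ by positivity
  have htd : t * d = δ / 2 := by rw [ht]; field_simp
  have ht1 : t ≤ 1 / 2 := by nlinarith
  have hmem : (1 - t) • a + t • y ∈ s := hF.1 ha hy (by linarith) ht0.le (by ring)
  have hlow : F a - 1 < F ((1 - t) • a + t • y) := hnear _ hmem <| by
    rw [show (1 - t) • a + t • y - a = t • (y - a) by module, norm_smul,
      Real.norm_of_nonneg ht0.le, htd]
    exact half_lt_self hδ
  have hup := hF.2 ha hy (by linarith : 0 ≤ 1 - t) ht0.le (by ring)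
  simp only [smul_eq_mul, norm_sub_rev a y] at hup
  have hslope : t * (F a - F y) < t * (2 * d / δ - m / 4 * d ^ 2) := by
    have htδ : t * (2 * d / δ) = 1 := by rw [ht]; field_simp
    nlinarith [mul_nonneg (mul_nonneg ht0.le (by linarith : 0 ≤ 1 / 2 - t))
      (by positivity : 0 ≤ m / 2 * d ^ 2)]
  have hsq : 2 * d / δ - m / 4 * d ^ 2 ≤ 4 / (m * δ ^ 2) := by
    have hnonneg : 0 ≤ m / 4 * (d - 4 / (m * δ)) ^ 2 := by positivity
    have hexpand : m / 4 * (d - 4 / (m * δ)) ^ 2 =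
        m / 4 * d ^ 2 - 2 * d / δ + 4 / (m * δ ^ 2) := by
      field_simp
      ring
    linarith
  linarith [lt_of_mul_lt_mul_left hslope ht0.le]

theorem bddBelow_image_of_strongConvexOn (hF : StrongConvexOn s m F) (hm : 0 < m)
    (hcl : ∀ c, IsClosed {x | x ∈ s ∧ F x ≤ c}) : BddBelow (F '' s) := by
  rcases s.eq_empty_or_nonempty with rfl | ⟨a, ha⟩
  · simp
  obtain ⟨δ, hδ, hball⟩ := Metric.mem_nhds_iff.1
    ((hcl (F a - 1)).isOpen_compl.mem_nhds (x := a) (by simp))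
  have hnear : ∀ z ∈ s, ‖z - a‖ < δ → F a - 1 < F z := fun z hz hzδ =>
    not_le.1 fun h => hball (mem_ball_iff_norm.2 hzδ) ⟨hz, h⟩
  refine ⟨min (F a - 1) (F a - 4 / (m * δ ^ 2)), ?_⟩
  rintro _ ⟨y, hy, rfl⟩
  rcases lt_or_ge ‖y - a‖ δ with hlt | hge
  · exact min_le_of_left_le (hnear y hy hlt).le
  · exact min_le_of_right_le
      (sub_le_of_strongConvexOn_of_le_norm_sub hF hm ha hy hδ hge hnear)

theorem dist_le_sqrt_of_strongConvexOn (hF : StrongConvexOn s m F) (hm : 0 < m) {μ δ : ℝ}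
    (hμ : ∀ y ∈ s, μ ≤ F y) {y z : E} (hy : y ∈ s) (hz : z ∈ s) (hyδ : F y ≤ μ + δ)
    (hzδ : F z ≤ μ + δ) : dist y z ≤ √(8 / m * δ) := by
  have hhalf : (0 : ℝ) ≤ 1 / 2 := by norm_num
  have hlow := hμ _ (hF.1 hy hz hhalf hhalf (by norm_num))
  have hup := hF.2 hy hz hhalf hhalf (by norm_num)
  simp only [smul_eq_mul] at hup
  rw [dist_eq_norm]
  refine Real.le_sqrt_of_sq_le ?_
  rw [div_mul_eq_mul_div, le_div_iff₀ hm]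
  linarith

theorem exists_isMinOn_of_strongConvexOn [CompleteSpace E] (hF : StrongConvexOn s m F)
    (hm : 0 < m) (hcl : ∀ c, IsClosed {x | x ∈ s ∧ F x ≤ c}) (hs : s.Nonempty) :
    ∃ p ∈ s, IsMinOn F s p := by
  set μ := sInf (F '' s)
  have hμ : ∀ y ∈ s, μ ≤ F y := fun y hy =>
    csInf_le (bddBelow_image_of_strongConvexOn hF hm hcl) (Set.mem_image_of_mem F hy)
  let T : ℕ → Set E := fun n => {x | x ∈ s ∧ F x ≤ μ + 1 / (n + 1)}
  have hdist : ∀ n, ∀ y ∈ T n, ∀ z ∈ T n, dist y z ≤ √(8 / m * (1 / (n + 1))) :=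
    fun n y hy z hz => dist_le_sqrt_of_strongConvexOn hF hm hμ hy.1 hz.1 hy.2 hz.2
  have hne : ∀ N, (⋂ n ≤ N, T n).Nonempty := fun N => by
    obtain ⟨_, ⟨y, hy, rfl⟩, hyN⟩ := exists_lt_of_csInf_lt (hs.image F)
      (lt_add_of_pos_right μ (Nat.one_div_pos_of_nat (n := N) (α := ℝ)))
    exact ⟨y, Set.mem_iInter₂.2 fun n hn =>
      ⟨hy, hyN.le.trans (add_le_add_right (Nat.one_div_le_one_div hn) μ)⟩⟩
  have hdiam : Tendsto (fun n => Metric.diam (T n)) atTop (𝓝 0) := by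
    refine squeeze_zero (fun n => Metric.diam_nonneg)
      (fun n => Metric.diam_le_of_forall_dist_le (Real.sqrt_nonneg _) (hdist n)) ?_
    simpa using ((tendsto_one_div_add_atTop_nhds_zero_nat (𝕜 := ℝ)).const_mul (8 / m)).sqrt
  obtain ⟨p, hp⟩ := Metric.nonempty_iInter_of_nonempty_biInter (fun n => hcl _)
    (fun n => Metric.isBounded_iff.2 ⟨_, fun y hy z hz => hdist n y hy z hz⟩) hne hdiam
  have hp : ∀ n, p ∈ T n := Set.mem_iInter.1 hp
  have hpμ : F p ≤ μ := ge_of_tendsto'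
    (by simpa using (tendsto_one_div_add_atTop_nhds_zero_nat (𝕜 := ℝ)).const_add μ)
    fun n => (hp n).2
  exact ⟨p, (hp 0).1, fun y hy => hpμ.trans (hμ y hy)⟩

theorem add_mul_norm_sub_sq_le_of_isMinOn (hF : StrongConvexOn s m F) {p y : E}
    (hmin : IsMinOn F s p) (hp : p ∈ s) (hy : y ∈ s) : F p + m / 2 * ‖y - p‖ ^ 2 ≤ F y := by
  have hlim : Tendsto (fun t : ℝ => F p + (1 - t) * (m / 2 * ‖y - p‖ ^ 2)) (𝓝[>] 0)
      (𝓝 (F p + (1 - 0) * (m / 2 * ‖y - p‖ ^ 2))) :=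
    (Continuous.tendsto (by fun_prop) 0).mono_left nhdsWithin_le_nhds
  rw [sub_zero, one_mul] at hlim
  refine le_of_tendsto hlim ?_
  filter_upwards [Ioo_mem_nhdsGT (zero_lt_one' ℝ)] with t ⟨ht0, ht1⟩
  have h1t : 0 ≤ 1 - t := by linarith
  have hlow : F p ≤ F ((1 - t) • p + t • y) := hmin (hF.1 hp hy h1t ht0.le (by ring))
  have hup := hF.2 hp hy h1t ht0.le (by ring)
  simp only [smul_eq_mul, norm_sub_rev p y] at hup
  refine le_of_mul_le_mul_left ?_ ht0
  linarith

theorem strongConvexOn_add_half_norm_sub_sq {φ : E → ℝ} (hφ : ConvexOn ℝ s φ) (x : E) :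
    StrongConvexOn s 1 fun y => φ y + 1 / 2 * ‖x - y‖ ^ 2 := by
  rw [strongConvexOn_iff_convex]
  have haff : ConvexOn ℝ s fun y => 1 / 2 * ‖x‖ ^ 2 - ⟪x, y⟫_ℝ :=
    (convexOn_const _ hφ.1).sub ((innerₛₗ ℝ x).concaveOn hφ.1)
  refine (hφ.add haff).congr fun y _ => ?_
  simp only [Pi.add_apply]
  rw [norm_sub_sq_real]
  ring

end StrongConvexity

section GammaZero

variable {E : Type*} [NormedAddCommGroup E]

theorem argmin_eq_of_forall_lt {F : E → EReal} {p : E} (hp : ∀ y ≠ p, F p < F y) :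
    argmin F = p := by
  have hmem : p ∈ argminSet F := fun y => by
    rcases eq_or_ne y p with rfl | hy
    exacts [le_rfl, (hp y hy).le]
  have huniq : ∃! x, x ∈ argminSet F :=
    ⟨p, hmem, fun y hy => by_contra fun hyp => (hp y hyp).not_ge (hy p)⟩
  rw [argmin, dif_pos huniq]
  exact huniq.unique huniq.choose_spec.1 hmem

variable [InnerProductSpace ℝ E] {f : E → EReal}

/-- The effective domain of an extended-real-valued function, on which members of `Γ₀` are
real-valued. -/
def effectiveDomain (f : E → EReal) : Set E :=
  {x | f x ≠ ⊤}

theorem IsGammaZero.coe_toReal (hf : IsGammaZero f) {x : E} (hx : x ∈ effectiveDomain f) :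
    ((f x).toReal : EReal) = f x :=
  EReal.coe_toReal hx (hf.ne_bot x)

theorem IsGammaZero.convexOn_toReal (hf : IsGammaZero f) :
    ConvexOn ℝ (effectiveDomain f) fun x => (f x).toReal := by
  have hle : ∀ x ∈ effectiveDomain f, ∀ y ∈ effectiveDomain f, ∀ a b : ℝ, 0 < a → 0 < b →
      a + b = 1 → f (a • x + b • y) ≤ ((a * (f x).toReal + b * (f y).toReal : ℝ) : EReal) := by
    intro x hx y hy a b ha hb hab
    have h := hf.convex x y a b ha hb hab
    rw [← hf.coe_toReal hx, ← hf.coe_toReal hy] at h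
    exact_mod_cast h
  have hdom : Convex ℝ (effectiveDomain f) :=
    convex_iff_forall_pos.2 fun x hx y hy a b ha hb hab =>
      ((hle x hx y hy a b ha hb hab).trans_lt (EReal.coe_lt_top _)).ne
  refine convexOn_iff_forall_pos.2 ⟨hdom, fun x hx y hy a b ha hb hab => ?_⟩
  have h := hle x hx y hy a b ha hb hab
  rw [← hf.coe_toReal (hdom hx hy ha.le hb.le hab)] at h
  exact_mod_cast h

theorem IsGammaZero.isClosed_setOf_toReal_add_le (hf : IsGammaZero f) {φ : E → ℝ}
    (hφ : Continuous φ) (c : ℝ) :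
    IsClosed {x | x ∈ effectiveDomain f ∧ (f x).toReal + φ x ≤ c} := by
  have hlsc : LowerSemicontinuous fun x => f x + (φ x : EReal) :=
    hf.lowerSemicontinuous.add' (continuous_coe_real_ereal.comp hφ).lowerSemicontinuous
      fun x => EReal.continuousAt_add (Or.inr (EReal.coe_ne_bot _)) (Or.inr (EReal.coe_ne_top _))
  convert hlsc.isClosed_preimage (c : EReal) using 1
  ext x
  by_cases hx : x ∈ effectiveDomain f
  · simp only [Set.mem_preimage, Set.mem_Iic, Set.mem_ofPred_eq, hx, true_and]
    rw [← hf.coe_toReal hx]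
    exact_mod_cast Iff.rfl
  · have hx' : f x = ⊤ := not_not.1 hx
    simp [hx, hx']

theorem scale_inv_scale {X : Type*} {γ : ℝ} (hγ : γ ≠ 0) (f : X → EReal) :
    scale γ⁻¹ (scale γ f) = f := by
  funext x
  rw [scale, scale, ← mul_assoc, ← EReal.coe_mul, inv_mul_cancel₀ hγ, EReal.coe_one, one_mul]

theorem isGammaZero_scale (hf : IsGammaZero f) {γ : ℝ} (hγ : 0 < γ) :
    IsGammaZero (scale γ f) := by
  have hγ' : (0 : EReal) ≤ γ := EReal.coe_nonneg.2 hγ.le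
  have hcont : Continuous fun t : EReal => (γ : EReal) * t :=
    continuous_iff_continuousAt.2 fun t => ContinuousAt.comp
      (f := fun t => ((γ : EReal), t)) (g := fun p : EReal × EReal => p.1 * p.2)
      (EReal.continuousAt_mul (by simp [hγ.ne']) (by simp [hγ.ne']) (by simp) (by simp))
      (Continuous.prodMk_right (γ : EReal)).continuousAt
  constructor
  · intro x
    simp [scale, EReal.mul_eq_bot, hf.ne_bot x, hγ'.not_gt]
  · obtain ⟨x, hx⟩ := hf.exists_ne_top
    refine ⟨x, ?_⟩
    simp [scale, EReal.mul_eq_top, hx, hf.ne_bot x, hγ'.not_gt]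
  · exact hcont.comp_lowerSemicontinuous hf.lowerSemicontinuous
      fun s t hst => mul_le_mul_of_nonneg_left hst hγ'
  · intro x y a b ha hb hab
    refine (mul_le_mul_of_nonneg_left (hf.convex x y a b ha hb hab) hγ').trans_eq ?_
    rw [EReal.left_distrib_of_nonneg_of_ne_top hγ' (EReal.coe_ne_top γ), mul_left_comm,
      mul_left_comm (γ : EReal)]
    rfl

theorem IsGammaZero.mem_effectiveDomain_of_mem_subdifferential (hf : IsGammaZero f) {x u : E}
    (hu : u ∈ subdifferential f x) : x ∈ effectiveDomain f := by
  obtain ⟨y, hy⟩ := hf.exists_ne_top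
  intro hx
  have h := hu y
  rw [hx, EReal.coe_add_top, top_le_iff] at h
  exact hy h

theorem IsGammaZero.mem_subdifferential_iff (hf : IsGammaZero f) {x u : E}
    (hx : x ∈ effectiveDomain f) : u ∈ subdifferential f x ↔
      ∀ y ∈ effectiveDomain f, ⟪y - x, u⟫_ℝ + (f x).toReal ≤ (f y).toReal := by
  refine forall_congr' fun y => ?_
  by_cases hy : y ∈ effectiveDomain f
  · rw [← hf.coe_toReal hx, ← hf.coe_toReal hy, forall_prop_of_true hy]
    exact_mod_cast Iff.rfl
  · have hy' : f y = ⊤ := not_not.1 hy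
    simp [hy, hy']

theorem IsGammaZero.sub_prox_mem_subdifferential [CompleteSpace E] (hf : IsGammaZero f) (x : E) :
    x - prox f x ∈ subdifferential f (prox f x) := by
  have hconv := strongConvexOn_add_half_norm_sub_sq hf.convexOn_toReal x
  obtain ⟨p, hp, hmin⟩ := exists_isMinOn_of_strongConvexOn hconv one_pos
    (hf.isClosed_setOf_toReal_add_le (by fun_prop)) hf.exists_ne_top
  have hgrowth : ∀ y ∈ effectiveDomain f, (f p).toReal + 1 / 2 * ‖x - p‖ ^ 2 +
      1 / 2 * ‖y - p‖ ^ 2 ≤ (f y).toReal + 1 / 2 * ‖x - y‖ ^ 2 :=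
    fun y hy => add_mul_norm_sub_sq_le_of_isMinOn hconv hmin hp hy
  have hprox : prox f x = p := by
    refine argmin_eq_of_forall_lt fun y hyp => ?_
    rw [← hf.coe_toReal hp]
    by_cases hy : y ∈ effectiveDomain f
    · rw [← hf.coe_toReal hy]
      have : 0 < ‖y - p‖ := norm_sub_pos_iff.2 hyp
      exact_mod_cast lt_of_lt_of_le (lt_add_of_pos_right _ (by positivity)) (hgrowth y hy)
    · rw [not_not.1 hy, EReal.top_add_coe]
      exact_mod_cast EReal.coe_lt_top _
  rw [hprox, hf.mem_subdifferential_iff hp]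
  intro y hy
  have hsq := norm_sub_sq_real (x - p) (y - p)
  rw [sub_sub_sub_cancel_right, real_inner_comm] at hsq
  linarith [hgrowth y hy]

theorem smul_mem_subdifferential_scale {γ : ℝ} (hγ : 0 ≤ γ) {x u : E}
    (hu : u ∈ subdifferential f x) : γ • u ∈ subdifferential (scale γ f) x := by
  intro y
  have hγ' : (0 : EReal) ≤ γ := EReal.coe_nonneg.2 hγ
  have h := mul_le_mul_of_nonneg_left (hu y) hγ'
  rwa [EReal.left_distrib_of_nonneg_of_ne_top hγ' (EReal.coe_ne_top γ), ← EReal.coe_mul,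
    ← real_inner_smul_right] at h

theorem IsGammaZero.inv_smul_sub_prox_scale_mem_subdifferential [CompleteSpace E]
    (hf : IsGammaZero f) {γ : ℝ} (hγ : 0 < γ) (x : E) :
    γ⁻¹ • (x - prox (scale γ f) x) ∈ subdifferential f (prox (scale γ f) x) := by
  have h := smul_mem_subdifferential_scale (inv_nonneg.2 hγ.le)
    ((isGammaZero_scale hf hγ).sub_prox_mem_subdifferential x)
  rwa [scale_inv_scale hγ.ne'] at h

end GammaZero

section WeakConvergence

variable {ι E : Type*} [NormedAddCommGroup E] [InnerProductSpace ℝ E] [CompleteSpace E]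
  {l : Filter ι}

theorem tendsto_toWeakSpace_iff_inner {x : ι → E} {a : E} :
    Tendsto (fun i => toWeakSpace ℝ E (x i)) l (𝓝 (toWeakSpace ℝ E a)) ↔
      ∀ u, Tendsto (fun i => ⟪x i, u⟫_ℝ) l (𝓝 ⟪a, u⟫_ℝ) := by
  have hinj : Function.Injective (topDualPairing ℝ E).flip := fun b c hbc =>
    ext_inner_left ℝ fun u => by
      simpa using LinearMap.congr_fun hbc (InnerProductSpace.toDual ℝ E u)
  refine (WeakBilin.tendsto_iff_forall_eval_tendsto _ hinj).trans ?_
  rw [(InnerProductSpace.toDual ℝ E).surjective.forall]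
  refine forall_congr' fun u => ?_
  simp only [real_inner_comm u]
  rfl

theorem isCompact_toWeakSpace_image_closedBall (r : ℝ) :
    IsCompact (toWeakSpace ℝ E '' Metric.closedBall 0 r) := by
  let Φ : WeakDual ℝ E → WeakSpace ℝ E := fun φ =>
    toWeakSpace ℝ E ((InnerProductSpace.toDual ℝ E).symm (WeakDual.toStrongDual φ))
  have hΦ : Continuous Φ := by
    refine WeakBilin.continuous_of_continuous_eval _ fun ψ => ?_
    convert WeakDual.eval_continuous ((InnerProductSpace.toDual ℝ E).symm ψ) using 2 with φ
    change ψ ((InnerProductSpace.toDual ℝ E).symm (WeakDual.toStrongDual φ)) = _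
    rw [← InnerProductSpace.toDual_symm_apply, real_inner_comm,
      InnerProductSpace.toDual_symm_apply, WeakDual.toStrongDual_apply]
  convert (WeakDual.isCompact_closedBall (0 : StrongDual ℝ E) r).image hΦ using 1
  ext x
  constructor
  · rintro ⟨a, ha, rfl⟩
    refine ⟨StrongDual.toWeakDual (InnerProductSpace.toDual ℝ E a), ?_, ?_⟩
    · simpa using ha
    · simp [Φ]
  · rintro ⟨φ, hφ, rfl⟩
    exact ⟨_, by simpa using hφ, rfl⟩

theorem tendsto_inner_of_tendsto_toWeakSpace {x u : ι → E} {a b : E}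
    (hbdd : IsBoundedUnder (· ≤ ·) l fun i => ‖x i‖)
    (hx : Tendsto (fun i => toWeakSpace ℝ E (x i)) l (𝓝 (toWeakSpace ℝ E a)))
    (hu : Tendsto u l (𝓝 b)) : Tendsto (fun i => ⟪x i, u i⟫_ℝ) l (𝓝 ⟪a, b⟫_ℝ) := by
  have hsmall : Tendsto (fun i => ⟪u i - b, x i⟫_ℝ) l (𝓝 0) :=
    (tendsto_sub_nhds_zero_iff.2 hu).op_zero_isBoundedUnder_le hbdd (fun u x => ⟪u, x⟫_ℝ)
      norm_inner_le_norm
  have h := hsmall.add (tendsto_toWeakSpace_iff_inner.1 hx b)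
  rw [zero_add] at h
  refine h.congr fun i => ?_
  rw [inner_sub_left, real_inner_comm (x i) (u i), real_inner_comm (x i) b, sub_add_cancel]

theorem inner_eq_of_mapClusterPt_toWeakSpace {x : ι → E} {a u : E} {t : ℝ}
    (ha : MapClusterPt (toWeakSpace ℝ E a) l fun i => toWeakSpace ℝ E (x i))
    (ht : Tendsto (fun i => ⟪x i, u⟫_ℝ) l (𝓝 t)) : ⟪a, u⟫_ℝ = t := by
  obtain ⟨U, hU, hUa⟩ := mapClusterPt_iff_ultrafilter.1 ha
  exact tendsto_nhds_unique (tendsto_toWeakSpace_iff_inner.1 hUa u) (ht.mono_left hU)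

omit [CompleteSpace E] in
theorem tendsto_inner_sub_of_tendsto_norm_sub {x : ι → E} {a b : E} {s t : ℝ}
    (ha : Tendsto (fun i => ‖x i - a‖) l (𝓝 s)) (hb : Tendsto (fun i => ‖x i - b‖) l (𝓝 t)) :
    Tendsto (fun i => ⟪x i, a - b⟫_ℝ) l (𝓝 ((t ^ 2 - s ^ 2 + ‖a‖ ^ 2 - ‖b‖ ^ 2) / 2)) := by
  refine (((((hb.pow 2).sub (ha.pow 2)).add_const (‖a‖ ^ 2)).sub_const (‖b‖ ^ 2)).div_const
    2).congr fun i => ?_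
  rw [norm_sub_sq_real, norm_sub_sq_real, inner_sub_right]
  ring

theorem exists_tendsto_toWeakSpace_of_tendsto_norm_sub [l.NeBot] {S : Set E} (hS : S.Nonempty)
    {x : ι → E} (hnorm : ∀ a ∈ S, ∃ t, Tendsto (fun i => ‖x i - a‖) l (𝓝 t))
    (hcluster : ∀ a, MapClusterPt (toWeakSpace ℝ E a) l (fun i => toWeakSpace ℝ E (x i)) →
      a ∈ S) :
    ∃ a ∈ S, Tendsto (fun i => toWeakSpace ℝ E (x i)) l (𝓝 (toWeakSpace ℝ E a)) := by
  obtain ⟨c, hc⟩ := hS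
  obtain ⟨t, ht⟩ := hnorm c hc
  obtain ⟨r, hr⟩ := ht.isBoundedUnder_le
  have hball : ∀ᶠ i in l, toWeakSpace ℝ E (x i) ∈
      toWeakSpace ℝ E '' Metric.closedBall 0 (r + ‖c‖) := by
    filter_upwards [eventually_map.1 hr] with i hi
    refine Set.mem_image_of_mem _ (mem_closedBall_zero_iff.2 ?_)
    linarith [norm_le_norm_sub_add (x i) c]
  have hcompact := isCompact_toWeakSpace_image_closedBall (E := E) (r + ‖c‖)
  obtain ⟨_, ⟨a, -, rfl⟩, ha⟩ := hcompact.exists_mapClusterPt (tendsto_principal.2 hball)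
  refine ⟨a, hcluster a ha, hcompact.tendsto_nhds_of_unique_mapClusterPt hball ?_⟩
  rintro _ ⟨b, -, rfl⟩ hb
  obtain ⟨s, hs⟩ := hnorm a (hcluster a ha)
  obtain ⟨t, ht⟩ := hnorm b (hcluster b hb)
  have hlim := tendsto_inner_sub_of_tendsto_norm_sub hs ht
  have hab : ⟪a - b, a - b⟫_ℝ = 0 := by
    rw [inner_sub_left, inner_eq_of_mapClusterPt_toWeakSpace ha hlim,
      inner_eq_of_mapClusterPt_toWeakSpace hb hlim, sub_self]
  rw [sub_eq_zero.1 (inner_self_eq_zero.1 hab)]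

omit [CompleteSpace E] in
theorem WeaklyConvergesTo.map {F : Type*} [NormedAddCommGroup F] [InnerProductSpace ℝ F]
    {x : ℕ → E} {a : E} (hx : WeaklyConvergesTo x a) (T : E →L[ℝ] F) :
    WeaklyConvergesTo (fun n => T (x n)) (T a) :=
  ((WeakSpace.map T).continuous.tendsto _).comp hx

end WeakConvergence

section MonotoneOperators

variable {E F : Type*} [NormedAddCommGroup E] [InnerProductSpace ℝ E]
  [NormedAddCommGroup F] [InnerProductSpace ℝ F] {A : E → Set E} {B : F → Set F}

/-- A monotone set-valued operator. -/
def IsMonotone (A : E → Set E) : Prop :=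
  ∀ ⦃x y u w⦄, u ∈ A x → w ∈ A y → 0 ≤ ⟪x - y, u - w⟫_ℝ

/-- A maximally monotone operator: a monotone operator whose graph contains every point that is
monotonically related to all of its points. -/
structure IsMaximalMonotone (A : E → Set E) : Prop where
  isMonotone : IsMonotone A
  mem_of_forall_inner_nonneg : ∀ ⦃x u⦄, (∀ y, ∀ w ∈ A y, 0 ≤ ⟪x - y, u - w⟫_ℝ) → u ∈ A x

theorem IsMonotone.isMaximalMonotone_of_forall_exists_sub_mem (hA : IsMonotone A)
    (hsurj : ∀ z, ∃ p, z - p ∈ A p) : IsMaximalMonotone A := by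
  refine ⟨hA, fun x u h => ?_⟩
  obtain ⟨p, hp⟩ := hsurj (x + u)
  have hneg := h p _ hp
  rw [show u - (x + u - p) = -(x - p) by abel, inner_neg_right, neg_nonneg,
    real_inner_self_nonpos, sub_eq_zero] at hneg
  rwa [← hneg, add_sub_cancel_left] at hp

theorem IsGammaZero.isMaximalMonotone_subdifferential [CompleteSpace E] {f : E → EReal}
    (hf : IsGammaZero f) : IsMaximalMonotone (subdifferential f) := by
  refine IsMonotone.isMaximalMonotone_of_forall_exists_sub_mem (fun x y u w hu hw => ?_)
    fun z => ⟨prox f z, hf.sub_prox_mem_subdifferential z⟩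
  have hx := hf.mem_effectiveDomain_of_mem_subdifferential hu
  have hy := hf.mem_effectiveDomain_of_mem_subdifferential hw
  have hxy := (hf.mem_subdifferential_iff hx).1 hu y hy
  have hyx := (hf.mem_subdifferential_iff hy).1 hw x hx
  rw [← neg_sub x y, inner_neg_left] at hxy
  rw [inner_sub_right]
  linarith

theorem isMaximalMonotone_zero : IsMaximalMonotone fun _ : E => ({0} : Set E) := by
  refine IsMonotone.isMaximalMonotone_of_forall_exists_sub_mem ?_ fun z => ⟨z, by simp⟩
  rintro x y _ _ rfl rfl
  simp

/-- The product operator `(x, y) ↦ A x × B y` on the Hilbert direct sum. -/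
def prodOperator (A : E → Set E) (B : F → Set F) (z : WithLp 2 (E × F)) : Set (WithLp 2 (E × F)) :=
  {w | w.fst ∈ A z.fst ∧ w.snd ∈ B z.snd}

theorem IsMaximalMonotone.exists_mem_inner_nonpos (hA : IsMaximalMonotone A) (x u : E) :
    ∃ y, ∃ w ∈ A y, ⟪x - y, u - w⟫_ℝ ≤ 0 := by
  by_contra! h
  have hu : u ∈ A x := hA.mem_of_forall_inner_nonneg fun y w hw => (h y w hw).le
  simpa using h x u hu

theorem IsMaximalMonotone.prod (hA : IsMaximalMonotone A) (hB : IsMaximalMonotone B) :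
    IsMaximalMonotone (prodOperator A B) := by
  constructor
  · intro z z' w w' hw hw'
    rw [WithLp.prod_inner_apply]
    exact add_nonneg (hA.isMonotone hw.1 hw'.1) (hB.isMonotone hw.2 hw'.2)
  · intro z u h
    have hsum : ∀ x, ∀ a ∈ A x, ∀ y, ∀ b ∈ B y,
        0 ≤ ⟪z.fst - x, u.fst - a⟫_ℝ + ⟪z.snd - y, u.snd - b⟫_ℝ := fun x a ha y b hb => by
      have := h (WithLp.toLp 2 (x, y)) (WithLp.toLp 2 (a, b)) ⟨ha, hb⟩
      rwa [WithLp.prod_inner_apply] at this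
    obtain ⟨x, a, ha, hxa⟩ := hA.exists_mem_inner_nonpos z.fst u.fst
    obtain ⟨y, b, hb, hyb⟩ := hB.exists_mem_inner_nonpos z.snd u.snd
    exact ⟨hA.mem_of_forall_inner_nonneg fun x' a' ha' => by linarith [hsum x' a' ha' y b hb],
      hB.mem_of_forall_inner_nonneg fun y' b' hb' => by linarith [hsum x a ha y' b' hb']⟩

/-- The sum `A + S` of a set-valued operator and a single-valued one. -/
def addMap (A : E → Set E) (S : E → E) (x : E) : Set E :=
  {u | u - S x ∈ A x}

theorem IsMaximalMonotone.addMap_of_skew (hA : IsMaximalMonotone A) {S : E → E}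
    (hS : ∀ x y, ⟪x - y, S x - S y⟫_ℝ = 0) : IsMaximalMonotone (addMap A S) := by
  have hinner : ∀ x y u w, ⟪x - y, u - S x - (w - S y)⟫_ℝ = ⟪x - y, u - w⟫_ℝ := fun x y u w => by
    rw [sub_sub_sub_comm, inner_sub_right, hS, sub_zero]
  constructor
  · intro x y u w hu hw
    simpa only [hinner] using hA.isMonotone hu hw
  · intro x u h
    refine hA.mem_of_forall_inner_nonneg fun y w hw => ?_
    have := h y (w + S y) (by simpa [addMap] using hw)
    rwa [← hinner, add_sub_cancel_right] at this

theorem IsMaximalMonotone.mem_of_tendsto [CompleteSpace E] (hA : IsMaximalMonotone A) {ι : Type*}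
    {l : Filter ι} [l.NeBot] {x u : ι → E} {a b : E} (hmem : ∀ i, u i ∈ A (x i))
    (hbdd : IsBoundedUnder (· ≤ ·) l fun i => ‖x i‖)
    (hx : Tendsto (fun i => toWeakSpace ℝ E (x i)) l (𝓝 (toWeakSpace ℝ E a)))
    (hu : Tendsto u l (𝓝 b)) : b ∈ A a := by
  refine hA.mem_of_forall_inner_nonneg fun y w hw => ?_
  have hlim : Tendsto (fun i => ⟪x i - y, u i - w⟫_ℝ) l (𝓝 ⟪a - y, b - w⟫_ℝ) := by
    simp only [inner_sub_left _ y]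
    exact (tendsto_inner_of_tendsto_toWeakSpace hbdd hx (hu.sub_const w)).sub
      (tendsto_const_nhds.inner (hu.sub_const w))
  exact ge_of_tendsto' hlim fun i => hA.isMonotone (hmem i) hw

end MonotoneOperators

section HybridExtragradient

variable {E : Type*} [NormedAddCommGroup E] [InnerProductSpace ℝ E] {M A : E → Set E}

theorem norm_sub_sq_add_le_of_relative_error {z p u a : E} {γ σ : ℝ} (hγ : 0 ≤ γ)
    (hsep : 0 ≤ ⟪p - a, u⟫_ℝ) (herr : ‖γ • u - (z - p)‖ ≤ σ * ‖z - p‖) :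
    ‖z - γ • u - a‖ ^ 2 + (1 - σ ^ 2) * ‖z - p‖ ^ 2 ≤ ‖z - a‖ ^ 2 := by
  have hid : ‖z - a‖ ^ 2 - ‖z - γ • u - a‖ ^ 2 =
      ‖z - p‖ ^ 2 - ‖γ • u - (z - p)‖ ^ 2 + 2 * (γ * ⟪p - a, u⟫_ℝ) := by
    have h1 := norm_sub_sq_real (z - a) (γ • u)
    have h2 := norm_sub_sq_real (γ • u) (z - p)
    have h3 : ⟪z - a, γ • u⟫_ℝ = ⟪γ • u, z - p⟫_ℝ + γ * ⟪p - a, u⟫_ℝ := by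
      rw [← real_inner_smul_right, real_inner_comm (z - p), ← inner_add_left, sub_add_sub_cancel]
    rw [sub_right_comm z (γ • u) a]
    linarith
  have hsq := pow_le_pow_left₀ (norm_nonneg _) herr 2
  rw [mul_pow] at hsq
  linarith [mul_nonneg hγ hsep]

theorem exists_tendsto_of_add_le {φ β : ℕ → ℝ} (hφ : ∀ n, 0 ≤ φ n) (hβ : ∀ n, 0 ≤ β n)
    (h : ∀ n, φ (n + 1) + β n ≤ φ n) :
    (∃ t, Tendsto φ atTop (𝓝 t)) ∧ Tendsto β atTop (𝓝 0) := by
  have hanti : Antitone φ := antitone_nat_of_succ_le fun n => by linarith [h n, hβ n]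
  have hlim := tendsto_atTop_ciInf hanti ⟨0, Set.forall_mem_range.2 hφ⟩
  refine ⟨⟨_, hlim⟩, squeeze_zero hβ (fun n => le_sub_iff_add_le'.2 (h n)) ?_⟩
  simpa using hlim.sub (hlim.comp (tendsto_add_atTop_nat 1))

variable {σ ε : ℝ} {γ : ℕ → ℝ} {z p u : ℕ → E}

theorem tendsto_of_relative_error (hM : IsMonotone M) (hσ0 : 0 ≤ σ) (hσ1 : σ < 1)
    (hγ : ∀ n, 0 ≤ γ n) (hu : ∀ n, u n ∈ M (p n))
    (herr : ∀ n, ‖γ n • u n - (z n - p n)‖ ≤ σ * ‖z n - p n‖)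
    (hz : ∀ n, z (n + 1) = z n - γ n • u n) {a : E} (ha : 0 ∈ M a) :
    (∃ t, Tendsto (fun n => ‖z n - a‖) atTop (𝓝 t)) ∧
      Tendsto (fun n => z n - p n) atTop (𝓝 0) := by
  have hσ : 0 < 1 - σ ^ 2 := sub_pos.2 (pow_lt_one₀ hσ0 hσ1 two_ne_zero)
  obtain ⟨⟨t, ht⟩, hres⟩ := exists_tendsto_of_add_le (φ := fun n => ‖z n - a‖ ^ 2)
    (β := fun n => (1 - σ ^ 2) * ‖z n - p n‖ ^ 2) (fun n => by positivity)
    (fun n => by positivity) fun n => by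
      have hsep := hM (hu n) ha
      rw [sub_zero] at hsep
      rw [hz]
      exact norm_sub_sq_add_le_of_relative_error (hγ n) hsep (herr n)
  refine ⟨⟨√t, by simpa using ht.sqrt⟩, tendsto_zero_iff_norm_tendsto_zero.2 ?_⟩
  have h := hres.const_mul (1 - σ ^ 2)⁻¹
  simp only [inv_mul_cancel_left₀ hσ.ne', mul_zero] at h
  simpa using h.sqrt

theorem tendsto_zero_of_relative_error (hε : 0 < ε) (hγ : ∀ n, ε ≤ γ n)
    (herr : ∀ n, ‖γ n • u n - (z n - p n)‖ ≤ σ * ‖z n - p n‖)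
    (hres : Tendsto (fun n => z n - p n) atTop (𝓝 0)) : Tendsto u atTop (𝓝 0) := by
  refine squeeze_zero_norm (a := fun n => (σ + 1) / ε * ‖z n - p n‖) (fun n => ?_) ?_
  · have hle : ε * ‖u n‖ ≤ (σ + 1) * ‖z n - p n‖ := calc
      ε * ‖u n‖ ≤ γ n * ‖u n‖ := mul_le_mul_of_nonneg_right (hγ n) (norm_nonneg _)
      _ = ‖γ n • u n‖ := by rw [norm_smul, Real.norm_of_nonneg (hε.le.trans (hγ n))]
      _ ≤ ‖γ n • u n - (z n - p n)‖ + ‖z n - p n‖ := norm_le_norm_sub_add _ _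
      _ ≤ (σ + 1) * ‖z n - p n‖ := by linarith [herr n]
    rwa [div_mul_eq_mul_div, le_div_iff₀' hε]
  · simpa using hres.norm.const_mul ((σ + 1) / ε)

theorem exists_weaklyConvergesTo_of_relative_error [CompleteSpace E] (hM : IsMaximalMonotone M)
    (hzero : ∃ a, 0 ∈ M a) (hσ0 : 0 ≤ σ) (hσ1 : σ < 1) (hε : 0 < ε) (hγ : ∀ n, ε ≤ γ n)
    (hu : ∀ n, u n ∈ M (p n)) (herr : ∀ n, ‖γ n • u n - (z n - p n)‖ ≤ σ * ‖z n - p n‖)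
    (hz : ∀ n, z (n + 1) = z n - γ n • u n) :
    ∃ a, 0 ∈ M a ∧ WeaklyConvergesTo z a := by
  have hlim : ∀ {a}, 0 ∈ M a → _ := fun ha =>
    tendsto_of_relative_error hM.isMonotone hσ0 hσ1 (fun n => hε.le.trans (hγ n)) hu herr hz ha
  obtain ⟨c, hc⟩ := hzero
  obtain ⟨⟨t, ht⟩, hres⟩ := hlim hc
  have hbdd : IsBoundedUnder (· ≤ ·) atTop fun n => ‖p n‖ := by
    refine ((ht.add hres.norm).add_const ‖c‖).isBoundedUnder_le.mono_le (.of_forall fun n => ?_)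
    calc ‖p n‖ = ‖z n - c - (z n - p n) + c‖ := by congr 1; abel
      _ ≤ ‖z n - c‖ + ‖z n - p n‖ + ‖c‖ := norm_add_le_of_le (norm_sub_le _ _) le_rfl
  refine exists_tendsto_toWeakSpace_of_tendsto_norm_sub (S := {a | 0 ∈ M a}) ⟨c, hc⟩
    (fun a ha => (hlim ha).1) fun a ha => ?_
  obtain ⟨U, hU, hUa⟩ := mapClusterPt_iff_ultrafilter.1 ha
  have hpa : Tendsto (fun n => toWeakSpace ℝ E (p n)) U (𝓝 (toWeakSpace ℝ E a)) := by
    simpa using hUa.sub (((toWeakSpaceCLM ℝ E).continuous.tendsto 0).comp (hres.mono_left hU))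
  exact hM.mem_of_tendsto hu (hbdd.mono hU) hpa
    ((tendsto_zero_of_relative_error hε hγ herr hres).mono_left hU)

theorem exists_weaklyConvergesTo_of_forward_backward_forward [CompleteSpace E] {S : E → E}
    {K : ℝ} (hK : ∀ x y, ‖S x - S y‖ ≤ K * ‖x - y‖) (hM : IsMaximalMonotone (addMap A S))
    (hzero : ∃ a, -S a ∈ A a) (hε : 0 < ε) (hσ0 : 0 ≤ σ) (hσ1 : σ < 1)
    (hγ : ∀ n, ε ≤ γ n) (hγK : ∀ n, γ n * K ≤ σ)
    (hp : ∀ n, (γ n)⁻¹ • (z n - p n) - S (z n) ∈ A (p n))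
    (hz : ∀ n, z (n + 1) = p n - γ n • (S (p n) - S (z n))) :
    ∃ a, -S a ∈ A a ∧ WeaklyConvergesTo z a := by
  have hzero_iff : ∀ a, 0 ∈ addMap A S a ↔ -S a ∈ A a := fun a => by simp [addMap]
  simp only [← hzero_iff] at hzero ⊢
  have hu : ∀ n, γ n • ((γ n)⁻¹ • (z n - p n) + (S (p n) - S (z n))) =
      (z n - p n) + γ n • (S (p n) - S (z n)) := fun n => by
    rw [smul_add, smul_inv_smul₀ (hε.trans_le (hγ n)).ne']
  refine exists_weaklyConvergesTo_of_relative_error hM hzero hσ0 hσ1 hε hγ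
    (u := fun n => (γ n)⁻¹ • (z n - p n) + (S (p n) - S (z n))) (p := p) (fun n => ?_)
    (fun n => ?_) fun n => ?_
  · change _ - S (p n) ∈ A (p n)
    convert hp n using 1
    abel
  · have hγ0 : 0 ≤ γ n := hε.le.trans (hγ n)
    rw [hu, add_sub_cancel_left, norm_smul, Real.norm_of_nonneg hγ0, norm_sub_rev (z n)]
    calc γ n * ‖S (p n) - S (z n)‖ ≤ γ n * (K * ‖p n - z n‖) :=
          mul_le_mul_of_nonneg_left (hK _ _) hγ0
      _ ≤ σ * ‖p n - z n‖ := by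
          rw [← mul_assoc]
          exact mul_le_mul_of_nonneg_right (hγK n) (norm_nonneg _)
  · rw [hu, hz]
    abel

end HybridExtragradient

section ConstrainedInclusion

variable {W G : Type*} [NormedAddCommGroup W] [InnerProductSpace ℝ W] [CompleteSpace W]
  [NormedAddCommGroup G] [InnerProductSpace ℝ G] [CompleteSpace G] (T : W →L[ℝ] G)

/-- The skew map `(w, v) ↦ (T^* v, -T w)`, which couples the inclusion `-T^* v ∈ A w` to the
constraint `T w = 0`. -/
noncomputable def skewMap (z : WithLp 2 (W × G)) : WithLp 2 (W × G) :=
  WithLp.toLp 2 (T.adjoint z.snd, -T z.fst)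

theorem skewMap_fst (z : WithLp 2 (W × G)) : (skewMap T z).fst = T.adjoint z.snd :=
  rfl

theorem skewMap_snd (z : WithLp 2 (W × G)) : (skewMap T z).snd = -T z.fst :=
  rfl

theorem skewMap_sub (z z' : WithLp 2 (W × G)) :
    skewMap T z - skewMap T z' = skewMap T (z - z') := by
  rw [skewMap, skewMap, ← WithLp.toLp_sub]
  simp only [skewMap, WithLp.sub_fst, WithLp.sub_snd, map_sub, Prod.mk_sub_mk, neg_sub_neg, neg_sub]

theorem inner_skewMap_self (z : WithLp 2 (W × G)) : ⟪z, skewMap T z⟫_ℝ = 0 := by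
  simp [skewMap, WithLp.prod_inner_apply, ContinuousLinearMap.adjoint_inner_right,
    real_inner_comm]

theorem norm_skewMap_le (z : WithLp 2 (W × G)) : ‖skewMap T z‖ ≤ ‖T‖ * ‖z‖ := by
  refine le_of_sq_le_sq ?_ (by positivity)
  have hfst := pow_le_pow_left₀ (norm_nonneg _) (T.adjoint.le_opNorm z.snd) 2
  have hsnd := pow_le_pow_left₀ (norm_nonneg _) (T.le_opNorm z.fst) 2
  rw [ContinuousLinearMap.adjoint.norm_map] at hfst
  rw [mul_pow] at hfst hsnd
  rw [mul_pow, WithLp.prod_norm_sq_eq_of_L2, WithLp.prod_norm_sq_eq_of_L2 z, skewMap_fst,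
    skewMap_snd, norm_neg]
  linarith

variable {T} {A : W → Set W}

theorem exists_weaklyConvergesTo_of_linear_constraint (hA : IsMaximalMonotone A)
    (hzero : ∃ w v, -T.adjoint v ∈ A w ∧ T w = 0) {σ ε : ℝ} (hε : 0 < ε) (hσ : σ < 1)
    {γ : ℕ → ℝ} (hγ : ∀ n, ε ≤ γ n) (hγT : ∀ n, γ n * ‖T‖ ≤ σ) {w p : ℕ → W}
    {v : ℕ → G} (hp : ∀ n, (γ n)⁻¹ • (w n - γ n • T.adjoint (v n) - p n) ∈ A (p n))
    (hw : ∀ n, w (n + 1) = p n - γ n • T.adjoint (γ n • T (w n)))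
    (hv : ∀ n, v (n + 1) = v n + γ n • T (p n)) :
    ∃ a b, -T.adjoint b ∈ A a ∧ T a = 0 ∧ WeaklyConvergesTo (fun n => WithLp.toLp 2 (w n, v n))
      (WithLp.toLp 2 (a, b)) := by
  have hiff : ∀ z : WithLp 2 (W × G), -skewMap T z ∈ prodOperator A (fun _ => {0}) z ↔
      -T.adjoint z.snd ∈ A z.fst ∧ T z.fst = 0 := fun z => by
    simp [prodOperator, skewMap]
  have hM : IsMaximalMonotone (addMap (prodOperator A fun _ => {0}) (skewMap T)) :=
    (hA.prod isMaximalMonotone_zero).addMap_of_skew fun z z' => by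
      rw [skewMap_sub, inner_skewMap_self]
  have hγ0 : ∀ n, γ n ≠ 0 := fun n => (hε.trans_le (hγ n)).ne'
  obtain ⟨w₀, v₀, hwv, hw₀⟩ := hzero
  -- The resolvent of `0` is the identity, so the dual half of `p` is the explicit `v + γ T w`.
  obtain ⟨a, ha, hza⟩ := exists_weaklyConvergesTo_of_forward_backward_forward
    (z := fun n => WithLp.toLp 2 (w n, v n))
    (p := fun n => WithLp.toLp 2 (p n, v n + γ n • T (w n)))
    (fun z z' => skewMap_sub T z z' ▸ norm_skewMap_le T (z - z')) hM
    ⟨WithLp.toLp 2 (w₀, v₀), (hiff _).2 ⟨hwv, hw₀⟩⟩ hε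
    ((mul_nonneg (hε.le.trans (hγ 0)) (norm_nonneg T)).trans (hγT 0)) hσ hγ hγT
    (fun n => by
      have hpn := hp n
      rw [sub_right_comm, smul_sub, inv_smul_smul₀ (hγ0 n)] at hpn
      exact ⟨hpn, by simp [skewMap_snd, inv_smul_smul₀ (hγ0 n)]⟩)
    (fun n => by
      rw [skewMap_sub]
      refine WithLp.ofLp_injective 2 (Prod.ext ?_ ?_)
      · simp [skewMap, hw]
      · simp [skewMap, hv, smul_sub, add_sub_assoc])
  exact ⟨a.fst, a.snd, ((hiff a).1 ha).1, ((hiff a).1 ha).2, hza⟩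

end ConstrainedInclusion

section CompositeInclusion

variable {H G : Type*} [NormedAddCommGroup H] [InnerProductSpace ℝ H]
  [NormedAddCommGroup G] [InnerProductSpace ℝ G] (L : H →L[ℝ] G)

/-- The operator `(x, y) ↦ L x - y`, whose kernel is the graph of `L`. -/
noncomputable def graphDefect : WithLp 2 (H × G) →L[ℝ] G :=
  L ∘L WithLp.fstL 2 ℝ H G - WithLp.sndL 2 ℝ H G

theorem graphDefect_apply (z : WithLp 2 (H × G)) : graphDefect L z = L z.fst - z.snd :=
  rfl

theorem norm_graphDefect_le : ‖graphDefect L‖ ≤ √(1 + ‖L‖ ^ 2) := by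
  refine ContinuousLinearMap.opNorm_le_bound _ (Real.sqrt_nonneg _) fun z => ?_
  have htri : ‖graphDefect L z‖ ≤ ‖L‖ * ‖z.fst‖ + ‖z.snd‖ :=
    (norm_sub_le _ _).trans (add_le_add_left (L.le_opNorm _) _)
  refine htri.trans (le_of_sq_le_sq ?_ (by positivity))
  rw [mul_pow, Real.sq_sqrt (by positivity), WithLp.prod_norm_sq_eq_of_L2]
  linarith [sq_nonneg (‖L‖ * ‖z.snd‖ - ‖z.fst‖)]

variable [CompleteSpace H] [CompleteSpace G]

theorem adjoint_graphDefect_apply (v : G) :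
    (graphDefect L).adjoint v = WithLp.toLp 2 (L.adjoint v, -v) := by
  refine ext_inner_right ℝ fun z => ?_
  rw [ContinuousLinearMap.adjoint_inner_left, WithLp.prod_inner_apply, graphDefect_apply]
  simp [ContinuousLinearMap.adjoint_inner_left, inner_sub_right, ← sub_eq_add_neg]

variable {L}

theorem exists_weaklyConvergesTo_of_composite {A : H → Set H} {B : G → Set G}
    (hA : IsMaximalMonotone A) (hB : IsMaximalMonotone B)
    (hzero : ∃ x v, -L.adjoint v ∈ A x ∧ v ∈ B (L x)) {σ ε : ℝ} (hε : 0 < ε) (hσ : σ < 1)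
    {γ : ℕ → ℝ} (hγ : ∀ n, ε ≤ γ n) (hγL : ∀ n, γ n * √(1 + ‖L‖ ^ 2) ≤ σ) {x p : ℕ → H}
    {y q v : ℕ → G} (hp : ∀ n, (γ n)⁻¹ • (x n - γ n • L.adjoint (v n) - p n) ∈ A (p n))
    (hq : ∀ n, (γ n)⁻¹ • (y n + γ n • v n - q n) ∈ B (q n))
    (hx : ∀ n, x (n + 1) = p n - γ n • L.adjoint (γ n • (L (x n) - y n)))
    (hy : ∀ n, y (n + 1) = q n + γ n • γ n • (L (x n) - y n))
    (hv : ∀ n, v (n + 1) = v n + γ n • (L (p n) - q n)) :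
    ∃ a b, -L.adjoint b ∈ A a ∧ b ∈ B (L a) ∧ WeaklyConvergesTo x a ∧ WeaklyConvergesTo v b := by
  have hγ0 : ∀ n, 0 ≤ γ n := fun n => hε.le.trans (hγ n)
  have hiff : ∀ (z : WithLp 2 (H × G)) b,
      -(graphDefect L).adjoint b ∈ prodOperator A B z ↔ -L.adjoint b ∈ A z.fst ∧ b ∈ B z.snd :=
    fun z b => by simp [adjoint_graphDefect_apply, prodOperator]
  obtain ⟨x₀, v₀, hx₀, hv₀⟩ := hzero
  obtain ⟨a, b, hab, hker, hlim⟩ := exists_weaklyConvergesTo_of_linear_constraint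
    (T := graphDefect L) (w := fun n => WithLp.toLp 2 (x n, y n))
    (p := fun n => WithLp.toLp 2 (p n, q n)) (v := v) (hA.prod hB)
    ⟨WithLp.toLp 2 (x₀, L x₀), v₀, (hiff _ _).2 ⟨hx₀, hv₀⟩, by simp [graphDefect_apply]⟩ hε
    hσ hγ
    (fun n => (mul_le_mul_of_nonneg_left (norm_graphDefect_le L) (hγ0 n)).trans (hγL n))
    (fun n => by
      rw [adjoint_graphDefect_apply]
      exact ⟨by simpa using hp n, by simpa using hq n⟩)
    (fun n => by
      rw [adjoint_graphDefect_apply]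
      refine WithLp.ofLp_injective 2 (Prod.ext ?_ ?_)
      · simp [graphDefect_apply, hx]
      · simp [graphDefect_apply, hy])
    (fun n => by simp [graphDefect_apply, hv])
  have hLa : L a.fst = a.snd := sub_eq_zero.1 ((graphDefect_apply L a).symm.trans hker)
  rw [hiff, ← hLa] at hab
  have hfst := hlim.map (WithLp.fstL 2 ℝ (WithLp 2 (H × G)) G)
  exact ⟨a.fst, b, hab.1, hab.2, hfst.map (WithLp.fstL 2 ℝ H G),
    hlim.map (WithLp.sndL 2 ℝ (WithLp 2 (H × G)) G)⟩

end CompositeInclusion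

section Duality

variable {E : Type*} [NormedAddCommGroup E] [InnerProductSpace ℝ E]

theorem inner_sub_le_conjugate (f : E → EReal) (x u : E) :
    ((⟪x, u⟫_ℝ : ℝ) : EReal) - f x ≤ conjugate f u :=
  le_iSup (fun x => ((⟪x, u⟫_ℝ : ℝ) : EReal) - f x) x

theorem conjugate_eq_of_mem_subdifferential {f : E → EReal} {x u : E}
    (hu : u ∈ subdifferential f x) : conjugate f u = ((⟪x, u⟫_ℝ : ℝ) : EReal) - f x := by
  refine le_antisymm (iSup_le fun y => ?_) (inner_sub_le_conjugate f x u)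
  have hsplit : ((⟪y, u⟫_ℝ : ℝ) : EReal) - ((⟪y - x, u⟫_ℝ : ℝ) : EReal) =
      ((⟪x, u⟫_ℝ : ℝ) : EReal) := by
    rw [← EReal.coe_sub, ← inner_sub_left, sub_sub_cancel]
  calc ((⟪y, u⟫_ℝ : ℝ) : EReal) - f y
      ≤ ((⟪y, u⟫_ℝ : ℝ) : EReal) - (((⟪y - x, u⟫_ℝ : ℝ) : EReal) + f x) :=
        EReal.sub_le_sub le_rfl (hu y)
    _ = ((⟪x, u⟫_ℝ : ℝ) : EReal) - f x := by
        rw [← hsplit, sub_eq_add_neg, EReal.neg_add (.inl (EReal.coe_ne_bot _))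
          (.inl (EReal.coe_ne_top _)), sub_eq_add_neg, ← add_assoc, ← sub_eq_add_neg,
          ← sub_eq_add_neg]

variable {H G : Type*} [NormedAddCommGroup H] [InnerProductSpace ℝ H] [CompleteSpace H]
  [NormedAddCommGroup G] [InnerProductSpace ℝ G] [CompleteSpace G]
  {f : H → EReal} {g : G → EReal} {L : H →L[ℝ] G} {x : H} {v : G}

theorem inner_neg_adjoint_add_inner (x : H) (v : G) :
    ((⟪x, -L.adjoint v⟫_ℝ : ℝ) : EReal) + ((⟪L x, v⟫_ℝ : ℝ) : EReal) = 0 := by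
  rw [← EReal.coe_add, inner_neg_right, ContinuousLinearMap.adjoint_inner_right, neg_add_cancel,
    EReal.coe_zero]

theorem mem_argminSet_primalObjective (hx : -L.adjoint v ∈ subdifferential f x)
    (hv : v ∈ subdifferential g (L x)) : x ∈ argminSet (primalObjective f g L) := fun y => by
  have h := add_le_add (hx y) (hv (L y))
  rwa [add_add_add_comm, ← map_sub, inner_neg_adjoint_add_inner, zero_add] at h

theorem inner_sub_add_inner_sub_eq (x : H) (v : G) (s t : EReal) :
    ((⟪x, -L.adjoint v⟫_ℝ : ℝ) : EReal) - s + (((⟪L x, v⟫_ℝ : ℝ) : EReal) - t) = -s + -t := by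
  rw [sub_eq_add_neg, sub_eq_add_neg, add_add_add_comm, inner_neg_adjoint_add_inner, zero_add]

theorem mem_argminSet_dualObjective (hx : -L.adjoint v ∈ subdifferential f x)
    (hv : v ∈ subdifferential g (L x)) : v ∈ argminSet (dualObjective f g L) := fun w => calc
  dualObjective f g L v = -f x + -g (L x) := by
    rw [dualObjective, conjugate_eq_of_mem_subdifferential hx,
      conjugate_eq_of_mem_subdifferential hv, inner_sub_add_inner_sub_eq]
  _ ≤ dualObjective f g L w := by
    rw [← inner_sub_add_inner_sub_eq (L := L) x w]
    exact add_le_add (inner_sub_le_conjugate f _ _) (inner_sub_le_conjugate g _ _)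

theorem zero_mem_setValuedRange_primalOperator_iff :
    0 ∈ setValuedRange (primalOperator f g L) ↔
      ∃ x v, -L.adjoint v ∈ subdifferential f x ∧ v ∈ subdifferential g (L x) := by
  refine exists_congr fun x => ⟨?_, fun ⟨v, hx, hv⟩ => ?_⟩
  · rintro ⟨u, hu, _, ⟨v, hv, rfl⟩, huv⟩
    exact ⟨v, eq_neg_of_add_eq_zero_left huv ▸ hu, hv⟩
  · exact ⟨-L.adjoint v, hx, L.adjoint v, Set.mem_image_of_mem _ hv, neg_add_cancel _⟩

end Duality

end ConvexDuality

theorem proposition4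
    {H : Type*} [NormedAddCommGroup H] [InnerProductSpace ℝ H] [CompleteSpace H]
    {G : Type*} [NormedAddCommGroup G] [InnerProductSpace ℝ G] [CompleteSpace G]
    (f : H → EReal) (hf : IsGammaZero f)
    (g : G → EReal) (hg : IsGammaZero g)
    (L : H →L[ℝ] G) (hL : L ≠ 0)
    (hran : (0 : H) ∈ setValuedRange (primalOperator f g L))
    (ε : ℝ) (hε : 0 < ε)
    (γ : ℕ → ℝ) (hγ : ∀ n, ε ≤ γ n ∧ γ n ≤ (1 - ε) / √(1 + ‖L‖ ^ 2))
    (x : ℕ → H) (y : ℕ → G) (v : ℕ → G)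
    (r : ℕ → G) (p : ℕ → H) (q : ℕ → G)
    (hr : ∀ n, r n = γ n • (L (x n) - y n))
    (hp : ∀ n, p n = prox (scale (γ n) f) (x n - γ n • L.adjoint (v n)))
    (hq : ∀ n, q n = prox (scale (γ n) g) (y n + γ n • v n))
    (hx : ∀ n, x (n + 1) = p n - γ n • L.adjoint (r n))
    (hy : ∀ n, y (n + 1) = q n + γ n • r n)
    (hv : ∀ n, v (n + 1) = v n + γ n • (L (p n) - q n)) :
    (∃ xbar ∈ argminSet (primalObjective f g L), WeaklyConvergesTo x xbar) ∧
      (∃ vbar ∈ argminSet (dualObjective f g L), WeaklyConvergesTo v vbar) := by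
  have hγ0 : ∀ n, 0 < γ n := fun n => hε.trans_le (hγ n).1
  obtain ⟨a, b, ha, hb, hxa, hvb⟩ := exists_weaklyConvergesTo_of_composite
    hf.isMaximalMonotone_subdifferential hg.isMaximalMonotone_subdifferential
    (zero_mem_setValuedRange_primalOperator_iff.1 hran) hε (sub_lt_self 1 hε)
    (fun n => (hγ n).1) (fun n => (le_div_iff₀ (by positivity)).1 (hγ n).2)
    (fun n => hp n ▸ hf.inv_smul_sub_prox_scale_mem_subdifferential (hγ0 n) _)
    (fun n => hq n ▸ hg.inv_smul_sub_prox_scale_mem_subdifferential (hγ0 n) _)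
    (fun n => hr n ▸ hx n) (fun n => hr n ▸ hy n) hv
  exact ⟨⟨a, mem_argminSet_primalObjective ha hb, hxa⟩,
    ⟨b, mem_argminSet_dualObjective ha hb, hvb⟩⟩
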